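/- Let $n\ge 1$ and let $\mathbb S^n\subset\mathbb R^{n+1}$ be the unit sphere with its standard metric $e=e_{ij}du^idu^j$, $e_{ij}=\langle x_i,x_j\rangle$. For a positive function $\rho\in C^2(\mathbb S^n)$ (the radial function of the hypersurface $R$ given by $r(x)=\rho(x)x$, $x\in\mathbb S^n$), let $$N=\frac{\rho x-\nabla\rho}{\sqrt{\rho^2+|\nabla\rho|^2}}$$ be the unit normal field of $R$, let $\gamma(x)=x-2\langle x,N(x)\rangle N(x)$ be the reflector map, and let $\kappa_{ij}=-\langle \partial_i r,\partial_j\gamma\rangle/\rho$ be the intensity form. The principal intensities $\lambda_1,\dots,\lambda_n$ at $x$ are the roots, with multiplicity, of the characteristic polynomial of the matrix $[e^{is}\kappa_{sj}]$, and $S_1[\rho](x)=\lambda_1+\dots+\lambda_n$. Let $0<R_1<R_2<\infty$, $\alpha\in(0,1)$, and let $g$ be a positive $C^{1,\alpha}$ function on the closed annulus $\{tx: x\in\mathbb S^n,\ t\in[R_1,R_2]\}\subset\mathbb R^{n+1}$; write $g(x,t)$ for its value at $tx$. Assume that $$g(x,R_1)\ge 1\quad\text{and}\quad g(x,R_2)\le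 1\qquad\text{for all }x\in\mathbb S^n.$$ By a solution we mean a positive $\rho\in C^2(\mathbb S^n)$ with $R_1\le\rho\le R_2$ on $\mathbb S^n$ and $$S_1[\rho](x)=n\,g(x,\rho(x))\qquad\text{for all }x\in\mathbb S^n.$$ (a) If, in addition, $\partial g/\partial t\,(x,t)\le 0$ for all $(x,t)\in\mathbb S^n\times[R_1,R_2]$ (one-sided derivatives at $t=R_1$ and $t=R_2$), then for any two solutions $\rho^1,\rho^2$ there is a constant $C>0$ with $\rho^1(x)=C\rho^2(x)$ for all $x\in\mathbb S^n$. (b) Every solution $\rho$ (whether or not the additional monotonicity assumption of (a) holds) satisfies $\rho\equiv R_1$, or $\rho\equiv R_2$, or $R_1<\rho(x)<R_2$ for all $x\in\mathbb S^n$. -/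

import Mathlib

open Metric Set
open scoped Manifold ContDiff NNReal

noncomputable section

namespace Reflector

/-- The ambient Euclidean space `ℝⁿ⁺¹`. -/
abbrev Ambient (n : ℕ) : Type := EuclideanSpace ℝ (Fin (n + 1))

/-- The unit sphere `𝕊ⁿ ⊂ ℝⁿ⁺¹`, a smooth manifold modelled on `ℝⁿ`. -/
abbrev Sph (n : ℕ) : Type := sphere (0 : Ambient n) 1

/-- The partial derivative `∂ᵢ f` at `x`, for the coordinates of the preferred chart at `x`, of a
map `f` from `𝕊ⁿ` to a normed space. -/
def pd {n : ℕ} {F : Type} [NormedAddCommGroup F] [NormedSpace ℝ F] (f : Sph n → F)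
    (x : Sph n) (i : Fin n) : F :=
  (mfderiv (𝓡 n) 𝓘(ℝ, F) f x : EuclideanSpace ℝ (Fin n) →L[ℝ] F) (EuclideanSpace.single i 1)

/-- The inclusion `x : 𝕊ⁿ → ℝⁿ⁺¹`. -/
def incl {n : ℕ} (x : Sph n) : Ambient n := x

/-- The coefficients `e_{ij} = ⟨x_i, x_j⟩` of the standard metric of `𝕊ⁿ`. -/
def metricE {n : ℕ} (x : Sph n) : Matrix (Fin n) (Fin n) ℝ :=
  Matrix.of fun i j => inner ℝ (pd incl x i) (pd incl x j)

/-- The gradient `∇ρ = e^{ij} ρ_i x_j` on `𝕊ⁿ`, as a vector of `ℝⁿ⁺¹` tangent to the sphere. -/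
def grad {n : ℕ} (ρ : Sph n → ℝ) (x : Sph n) : Ambient n :=
  ∑ i, ∑ j, ((metricE x)⁻¹ i j * pd ρ x i) • pd incl x j

/-- The position vector `r(x) = ρ(x) x` of the hypersurface with radial function `ρ`. -/
def position {n : ℕ} (ρ : Sph n → ℝ) (x : Sph n) : Ambient n := ρ x • incl x

/-- The unit normal `N = (ρ x - ∇ρ) / √(ρ² + |∇ρ|²)` of the hypersurface `r(x) = ρ(x) x`. -/
def unitNormal {n : ℕ} (ρ : Sph n → ℝ) (x : Sph n) : Ambient n :=
  (√(ρ x ^ 2 + ‖grad ρ x‖ ^ 2))⁻¹ • (ρ x • incl x - grad ρ x)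

/-- The reflector map `γ(x) = x - 2 ⟨x, N(x)⟩ N(x)`. -/
def reflect {n : ℕ} (ρ : Sph n → ℝ) (x : Sph n) : Ambient n :=
  incl x - (2 * inner ℝ (incl x) (unitNormal ρ x)) • unitNormal ρ x

/-- The coefficients `κ_{ij} = -⟨r_i, γ_j⟩ / ρ` of the intensity form. -/
def intensityForm {n : ℕ} (ρ : Sph n → ℝ) (x : Sph n) : Matrix (Fin n) (Fin n) ℝ :=
  Matrix.of fun i j => -inner ℝ (pd (position ρ) x i) (pd (reflect ρ) x j) / ρ x

/-- The principal intensities: the real roots, with multiplicity, of the characteristic polynomial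
of `a^i_j = e^{is} κ_{sj}`. -/
def principalIntensities {n : ℕ} (ρ : Sph n → ℝ) (x : Sph n) : Multiset ℝ :=
  ((metricE x)⁻¹ * intensityForm ρ x).charpoly.roots

/-- The `m`-th intensity function `S_m`: the `m`-th elementary symmetric function of the principal
intensities. -/
def intensityS {n : ℕ} (m : ℕ) (ρ : Sph n → ℝ) (x : Sph n) : ℝ :=
  (principalIntensities ρ x).esymm m

/-- `ρ` is the radial function of a hypersurface of class `𝓜ⁿ(𝕊ⁿ)`: it is positive and `C²`. -/
def IsRadialFunction {n : ℕ} (ρ : Sph n → ℝ) : Prop :=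
  ContMDiff (𝓡 n) 𝓘(ℝ, ℝ) 2 ρ ∧ ∀ x, 0 < ρ x

/-- The annulus `{ρ x : x ∈ 𝕊ⁿ, ρ ∈ [R₁, R₂]}` of `ℝⁿ⁺¹`. -/
def annulus (n : ℕ) (R₁ R₂ : ℝ) : Set (Ambient n) := {y | R₁ ≤ ‖y‖ ∧ ‖y‖ ≤ R₂}

/-- `g` is of class `C^{1,α}` on the set `A` (used for closed annuli): it is `C¹` and its
derivative is Hölder continuous on `A` with exponent `α`. -/
def IsC1Holder {n : ℕ} (α : ℝ≥0) (g : Ambient n → ℝ) (A : Set (Ambient n)) : Prop :=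
  ContDiffOn ℝ 1 g A ∧ ∃ K : ℝ≥0, HolderOnWith K α (fderivWithin ℝ g A) A

/-- `ρ` is a radial function with values in `[R₁, R₂]` that solves `S₁ = n g(x, ρ(x))`, where
`g(x, t)` is the value of `g` at the point `t x` of `ℝⁿ⁺¹`. -/
def IsSolution {n : ℕ} (R₁ R₂ : ℝ) (g : Ambient n → ℝ) (ρ : Sph n → ℝ) : Prop :=
  IsRadialFunction ρ ∧ (∀ x, ρ x ∈ Icc R₁ R₂) ∧
    ∀ x : Sph n, intensityS 1 ρ x = n * g (ρ x • (x : Ambient n))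

end Reflector

end

/-!
In terms of `u = log ρ`, the equation `S₁ = n g` is quasilinear elliptic on the sphere:
`Δu = |∇u|² + n - (n / 2) (1 + g(x, eᵘ)) (1 + |∇u|²)`. Both assertions are instances of the strong
minimum principle: a function `v ≥ 0` on the sphere with `Δv ≤ C (v + |∇v|)` vanishes identically or
is positive everywhere (`IsSphericalJet.eq_zero_or_pos`). It is applied to `log (ρ / R₁)`, to
`log (R₂ / ρ)`, and, for two solutions, to `max log (ρ₁ / ρ₂) - log (ρ₁ / ρ₂)`; in the first two
cases the boundary conditions on `g` and its Lipschitz continuity along rays give the differential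
inequality, in the third its monotonicity along rays.

All differential geometry is done in the ambient space. A function on the sphere is extended to
`ℝⁿ⁺¹ ∖ {0}` constantly along rays; at a point of the sphere, the Euclidean gradient of the extension
is the intrinsic gradient and its Euclidean Hessian restricts to the covariant Hessian on tangent
vectors. The coordinate frame at `x` of the preferred chart at `x` is orthonormal
(`exists_orthonormalBasis_pd_incl`), so that the metric matrix is the identity there, and a
computation gives `κᵢⱼ = b (uᵢ uⱼ - ∇ᵢⱼ u + δᵢⱼ) - δᵢⱼ` with `b = 2 / (1 + |∇u|²)`
(`IsRadialFunction.intensityForm_eq`), a symmetric matrix, whose trace is `S₁`.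

The strong minimum principle follows from an exponential barrier in the height function `⟨x, q⟩` and
the second-derivative test along great circles.
-/

namespace Reflector

/-! ### The coordinate frame of the sphere -/

/-- At the centre of the preferred (stereographic) chart, the coordinate vectors form an orthonormal
basis of the tangent space. The complement is that of `-x` because the chart at `x` projects from
`-x`. -/
theorem exists_orthonormalBasis_pd_incl {n : ℕ} (x : Sph n) :
    ∃ b : OrthonormalBasis (Fin n) ℝ (Submodule.span ℝ {((-x : Sph n) : Ambient n)})ᗮ,
      ∀ i, pd incl x i = (b i : Ambient n) := by
  have : Fact (Module.finrank ℝ (Ambient n) = n + 1) := Fact.mk (@finrank_euclideanSpace_fin ℝ _ (n + 1))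
  refine ⟨OrthonormalBasis.fromOrthogonalSpanSingleton (𝕜 := ℝ) n (ne_zero_of_mem_unit_sphere (-x)), ?_⟩
  intro i
  unfold pd
  have hmd : MDifferentiableAt (𝓡 n) 𝓘(ℝ, Ambient n) (incl : Sph n → Ambient n) x :=
    (contMDiff_coe_sphere (m := 1) (E := Ambient n) (n := n) x).mdifferentiableAt one_ne_zero
  -- in this chart, the inclusion is the inverse stereographic projection precomposed with an
  -- isometry, and its differential at the origin is that isometry
  rw [hmd.mfderiv]
  simp only [fderivWithin_univ, mfld_simps]
  let U := (OrthonormalBasis.fromOrthogonalSpanSingleton (𝕜 := ℝ) n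
    (ne_zero_of_mem_unit_sphere (-x))).repr
  have h0 : (chartAt (EuclideanSpace ℝ (Fin n)) x) x = 0 := by
    change U (stereographic (norm_eq_of_mem_sphere (-x)) x) = 0
    have : stereographic (norm_eq_of_mem_sphere (-x)) x = 0 := stereographic_neg_apply x
    rw [this, map_zero]
  have hU : U.symm (EuclideanSpace.single i 1) = OrthonormalBasis.fromOrthogonalSpanSingleton (𝕜 := ℝ) n
    (ne_zero_of_mem_unit_sphere (-x)) i := by
    rw [OrthonormalBasis.repr_symm_single]
  rw [← hU]
  have : HasFDerivAt (stereoInvFunAux ((-x : Sph n) : Ambient n) ∘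
      (Subtype.val : (Submodule.span ℝ {((-x : Sph n) : Ambient n)})ᗮ → Ambient n))
      (Submodule.span ℝ {((-x : Sph n) : Ambient n)})ᗮ.subtypeL (U.symm 0) := by
    convert! hasFDerivAt_stereoInvFunAux_comp_coe ((-x : Sph n) : Ambient n)
    exact map_zero _
  have h2 := (this.comp 0 U.symm.toContinuousLinearEquiv.hasFDerivAt).fderiv
  have h3 : (incl ∘ (chartAt (EuclideanSpace ℝ (Fin n)) x).symm : _ → Ambient n) =
    ((stereoInvFunAux ((-x : Sph n) : Ambient n) ∘
      (Subtype.val : (Submodule.span ℝ {((-x : Sph n) : Ambient n)})ᗮ → Ambient n)) ∘ U.symm) := rfl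
  rw [h0, h3]
  exact congr($h2 (EuclideanSpace.single i 1))

theorem inner_pd_incl_pd_incl {n : ℕ} (x : Sph n) (i j : Fin n) :
    inner ℝ (pd incl x i) (pd incl x j) = if i = j then 1 else 0 := by
  obtain ⟨b, hb⟩ := exists_orthonormalBasis_pd_incl x
  rw [hb, hb, ← Submodule.coe_inner, b.inner_eq_ite]

theorem inner_self_sph {n : ℕ} (x : Sph n) : inner ℝ (x : Ambient n) (x : Ambient n) = 1 := by
  rw [real_inner_self_eq_norm_sq, norm_eq_of_mem_sphere x]; norm_num

theorem inner_pd_incl_self {n : ℕ} (x : Sph n) (i : Fin n) :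
    inner ℝ (pd incl x i) (x : Ambient n) = 0 := by
  obtain ⟨b, hb⟩ := exists_orthonormalBasis_pd_incl x
  have := Submodule.mem_orthogonal_singleton_iff_inner_left.1 (b i).2
  rw [hb]
  simpa using this

theorem metricE_eq_one {n : ℕ} (x : Sph n) : metricE x = 1 := by
  ext i j
  simp [metricE, inner_pd_incl_pd_incl, Matrix.one_apply]

/-- Parseval's identity for the coordinate frame of the tangent space. -/
theorem sum_inner_pd_incl_mul {n : ℕ} (x : Sph n) {v w : Ambient n}
    (hv : inner ℝ v (x : Ambient n) = 0) (hw : inner ℝ w (x : Ambient n) = 0) :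
    ∑ i, inner ℝ (pd incl x i) v * inner ℝ (pd incl x i) w = inner ℝ v w := by
  obtain ⟨b, hb⟩ := exists_orthonormalBasis_pd_incl x
  have hmem : ∀ {v : Ambient n}, inner ℝ v (x : Ambient n) = 0 →
      v ∈ (Submodule.span ℝ {((-x : Sph n) : Ambient n)})ᗮ := fun h =>
    Submodule.mem_orthogonal_singleton_iff_inner_left.2 (by simpa using h)
  have := b.sum_inner_mul_inner ⟨v, hmem hv⟩ ⟨w, hmem hw⟩
  simp only [Submodule.coe_inner] at this
  rw [← this]
  refine Finset.sum_congr rfl fun i _ => ?_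
  rw [hb, real_inner_comm v]

theorem sum_inner_pd_incl_smul {n : ℕ} (x : Sph n) {v : Ambient n}
    (hv : inner ℝ v (x : Ambient n) = 0) :
    ∑ i, inner ℝ (pd incl x i) v • pd incl x i = v := by
  obtain ⟨b, hb⟩ := exists_orthonormalBasis_pd_incl x
  have hmem : v ∈ (Submodule.span ℝ {((-x : Sph n) : Ambient n)})ᗮ :=
    Submodule.mem_orthogonal_singleton_iff_inner_left.2 (by simpa using hv)
  have := congrArg Subtype.val (b.sum_repr' ⟨v, hmem⟩)
  rw [AddSubmonoidClass.coe_finsetSum] at this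
  simp only [hb]
  exact this

/-! ### Gradient and covariant Hessian from the ambient space -/

/-- `G` is the gradient field on `ℝⁿ⁺¹ ∖ {0}` of a function `V` constant along rays (or, at least,
with gradient orthogonal to the rays), and `A x` is the differential of `G` at the points of the
unit sphere. On the sphere, `G` is then the intrinsic gradient of the restriction of `V`, and `A`
induces its covariant Hessian on the tangent spaces. -/
structure IsSphericalJet {n : ℕ} (V : Ambient n → ℝ) (G : Ambient n → Ambient n)
    (A : Ambient n → Ambient n →L[ℝ] Ambient n) : Prop where
  hasGradientAt : ∀ z, z ≠ 0 → HasGradientAt V (G z) z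
  hasFDerivAt : ∀ x : Sph n, HasFDerivAt G (A x) x
  inner_eq_zero : ∀ z, inner ℝ (G z) z = 0

/-- The Laplacian on the sphere of a function with covariant Hessian induced by `A`. -/
noncomputable def sphLaplacian {n : ℕ} (A : Ambient n → Ambient n →L[ℝ] Ambient n) (x : Sph n) : ℝ :=
  ∑ i, inner ℝ (pd incl x i) (A x (pd incl x i))

namespace IsSphericalJet

variable {n : ℕ} {V W : Ambient n → ℝ} {G H : Ambient n → Ambient n}
  {A B : Ambient n → Ambient n →L[ℝ] Ambient n}

/-- Differentiating `⟨G z, z⟩ = 0` determines the normal component of `A x t`. -/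
theorem inner_apply_self (h : IsSphericalJet V G A) (x : Sph n) (t : Ambient n) :
    inner ℝ (A x t) (x : Ambient n) = -inner ℝ (G x) t := by
  have h1 := (h.hasFDerivAt x).inner ℝ (hasFDerivAt_id (x : Ambient n))
  have h2 : HasFDerivAt (fun z : Ambient n => inner ℝ (G z) (id z)) (0 : Ambient n →L[ℝ] ℝ) x := by
    simp only [id, h.inner_eq_zero]
    exact hasFDerivAt_const _ _
  have := congr($(h1.unique h2) t)
  simp [fderivInnerCLM_apply] at this
  linarith

theorem const_add (h : IsSphericalJet V G A) (c : ℝ) : IsSphericalJet (fun z => c + V z) G A where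
  hasGradientAt z hz := by
    have := (h.hasGradientAt z hz).hasFDerivAt.const_add c
    exact hasGradientAt_iff_hasFDerivAt.2 this
  hasFDerivAt := h.hasFDerivAt
  inner_eq_zero := h.inner_eq_zero

theorem neg (h : IsSphericalJet V G A) :
    IsSphericalJet (fun z => -V z) (fun z => -G z) (fun z => -A z) where
  hasGradientAt z hz := by
    have := (h.hasGradientAt z hz).hasFDerivAt.neg
    rw [hasGradientAt_iff_hasFDerivAt, map_neg]
    exact this
  hasFDerivAt x := (h.hasFDerivAt x).neg
  inner_eq_zero z := by simp [h.inner_eq_zero]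

theorem sub (h : IsSphericalJet V G A) (k : IsSphericalJet W H B) :
    IsSphericalJet (fun z => V z - W z) (fun z => G z - H z) (fun z => A z - B z) where
  hasGradientAt z hz := by
    have := (h.hasGradientAt z hz).hasFDerivAt.sub (k.hasGradientAt z hz).hasFDerivAt
    rw [hasGradientAt_iff_hasFDerivAt, map_sub]
    exact this
  hasFDerivAt x := (h.hasFDerivAt x).sub (k.hasFDerivAt x)
  inner_eq_zero z := by simp [inner_sub_left, h.inner_eq_zero, k.inner_eq_zero]

end IsSphericalJet

theorem sphLaplacian_neg {n : ℕ} (A : Ambient n → Ambient n →L[ℝ] Ambient n) (x : Sph n) :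
    sphLaplacian (fun z => -A z) x = -sphLaplacian A x := by
  simp [sphLaplacian]

theorem sphLaplacian_sub {n : ℕ} (A B : Ambient n → Ambient n →L[ℝ] Ambient n) (x : Sph n) :
    sphLaplacian (fun z => A z - B z) x = sphLaplacian A x - sphLaplacian B x := by
  simp [sphLaplacian, inner_sub_right]

/-! ### Second-order conditions along great circles -/

theorem deriv_eq_zero_and_nonneg_of_isLocalMin {f f' : ℝ → ℝ} {d x : ℝ} (hmin : IsLocalMin f x)
    (hf : ∀ y, HasDerivAt f (f' y) y) (hf' : HasDerivAt f' d x) : f' x = 0 ∧ 0 ≤ d := by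
  have h0 : f' x = 0 := hmin.hasDerivAt_eq_zero (hf x)
  refine ⟨h0, ?_⟩
  by_contra! hd
  have hdf : deriv f = f' := funext fun y => (hf y).deriv
  have hmax : IsLocalMax f x := by
    refine isLocalMax_of_deriv_deriv_neg ?_ ?_ (hf x).continuousAt
    · rw [hdf, hf'.deriv]; exact hd
    · rw [hdf, h0]
  -- `f` is then constant near `x`, so that its second derivative vanishes there
  have hc : f =ᶠ[nhds x] fun _ => f x := by
    filter_upwards [hmin, hmax] with y h1 h2 using le_antisymm h2 h1
  have := hc.deriv.deriv_eq
  rw [hdf, hf'.deriv] at this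
  simp at this
  exact hd.ne this

/-- The great circle through `x` with initial velocity `t`. -/
noncomputable def greatCircle {n : ℕ} (x t : Ambient n) (θ : ℝ) : Ambient n :=
  Real.cos θ • x + Real.sin θ • t

variable {n : ℕ}

theorem hasDerivAt_greatCircle (x t : Ambient n) (θ : ℝ) :
    HasDerivAt (greatCircle x t) (greatCircle t (-x) θ) θ := by
  have := ((Real.hasDerivAt_cos θ).smul_const x).add ((Real.hasDerivAt_sin θ).smul_const t)
  convert! this using 1
  simp only [greatCircle, smul_neg, neg_smul]
  abel

theorem norm_greatCircle (x : Sph n) (i : Fin n) (θ : ℝ) :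
    ‖greatCircle (x : Ambient n) (pd incl x i) θ‖ = 1 := by
  have h : ‖greatCircle (x : Ambient n) (pd incl x i) θ‖ ^ 2 = 1 := by
    rw [← real_inner_self_eq_norm_sq, greatCircle]
    simp only [inner_add_left, inner_add_right, real_inner_smul_left, real_inner_smul_right,
      inner_self_sph, inner_pd_incl_self, real_inner_comm (pd incl x i) (x : Ambient n),
      inner_pd_incl_pd_incl, if_true]
    have := Real.sin_sq_add_cos_sq θ
    linear_combination this
  nlinarith [norm_nonneg (greatCircle (x : Ambient n) (pd incl x i) θ)]

namespace IsSphericalJet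

variable {V : Ambient n → ℝ} {G : Ambient n → Ambient n} {A : Ambient n → Ambient n →L[ℝ] Ambient n}

theorem hasDerivAt_comp_greatCircle (h : IsSphericalJet V G A) (x : Sph n) (i : Fin n) (θ : ℝ) :
    HasDerivAt (fun θ => V (greatCircle x (pd incl x i) θ))
      (inner ℝ (G (greatCircle x (pd incl x i) θ)) (greatCircle (pd incl x i) (-x) θ)) θ := by
  have hne : greatCircle (x : Ambient n) (pd incl x i) θ ≠ 0 := by
    intro h0
    have := norm_greatCircle x i θ
    rw [h0] at this
    simp at this
  have := (h.hasGradientAt _ hne).hasFDerivAt.comp_hasDerivAt θ (hasDerivAt_greatCircle _ _ θ)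
  simp only [InnerProductSpace.toDual_apply_apply] at this
  exact this

/-- The second derivative of `V` along a great circle. The acceleration `-x` of the circle does not
contribute, `G x` being tangent. -/
theorem hasDerivAt_inner_greatCircle (h : IsSphericalJet V G A) (x : Sph n) (i : Fin n) :
    HasDerivAt (fun θ => inner ℝ (G (greatCircle x (pd incl x i) θ))
      (greatCircle (pd incl x i) (-x) θ))
      (inner ℝ (pd incl x i) (A x (pd incl x i))) 0 := by
  have h0 : ∀ x t : Ambient n, greatCircle x t 0 = x := fun x t => by simp [greatCircle]
  have hA : HasFDerivAt G (A x) (greatCircle x (pd incl x i) 0) := by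
    rw [h0]; exact h.hasFDerivAt x
  have := (hA.comp_hasDerivAt 0 (hasDerivAt_greatCircle _ _ 0)).inner ℝ
    (hasDerivAt_greatCircle (pd incl x i) (-x : Ambient n) 0)
  convert! this using 1
  simp only [Function.comp_apply, h0, inner_neg_right, h.inner_eq_zero]
  rw [real_inner_comm]
  simp

/-- First and second order conditions for a minimum on the sphere of `V - ε exp (a ⟨·, q⟩)`. -/
theorem of_isMin_sub_exp (h : IsSphericalJet V G A) {ε a : ℝ} {q : Ambient n} {y : Sph n}
    (hmin : ∀ x : Sph n, V y - ε * Real.exp (a * inner ℝ (y : Ambient n) q) ≤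
      V x - ε * Real.exp (a * inner ℝ (x : Ambient n) q)) (i : Fin n) :
    inner ℝ (G y) (pd incl y i) =
        ε * Real.exp (a * inner ℝ (y : Ambient n) q) * a * inner ℝ (pd incl y i) q ∧
      ε * Real.exp (a * inner ℝ (y : Ambient n) q) *
          (a ^ 2 * inner ℝ (pd incl y i) q ^ 2 - a * inner ℝ (y : Ambient n) q) ≤
        inner ℝ (pd incl y i) (A y (pd incl y i)) := by
  set t := pd incl y i with ht
  have h0 : ∀ x t : Ambient n, greatCircle x t 0 = x := fun x t => by simp [greatCircle]
  have hφ : ∀ (u v : Ambient n) (θ : ℝ), HasDerivAt (fun θ => inner ℝ (greatCircle u v θ) q)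
      (inner ℝ (greatCircle v (-u) θ) q) θ := fun u v θ => by
    simpa using (hasDerivAt_greatCircle u v θ).inner ℝ (hasDerivAt_const θ q)
  have hE : ∀ θ, HasDerivAt (fun θ => ε * Real.exp (a * inner ℝ (greatCircle y t θ) q))
      (ε * (Real.exp (a * inner ℝ (greatCircle y t θ) q) *
        (a * inner ℝ (greatCircle t (-y) θ) q))) θ :=
    fun θ => (((hφ y t θ).const_mul a).exp).const_mul ε
  have hE' := (((hφ y t 0).const_mul a).exp.mul ((hφ t (-y) 0).const_mul a)).const_mul ε
  have key := deriv_eq_zero_and_nonneg_of_isLocalMin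
    (f := fun θ => V (greatCircle y t θ) - ε * Real.exp (a * inner ℝ (greatCircle y t θ) q))
    (x := 0) (Filter.Eventually.of_forall fun θ => ?_)
    (fun θ => (h.hasDerivAt_comp_greatCircle y i θ).sub (hE θ))
    ((h.hasDerivAt_inner_greatCircle y i).sub hE')
  · simp only [h0, inner_neg_left] at key
    constructor
    · linear_combination key.1
    · nlinarith [key.2]
  · have := hmin ⟨greatCircle y t θ, by simpa using norm_greatCircle y i θ⟩
    simpa only [h0] using this

theorem continuous_sph (h : IsSphericalJet V G A) : Continuous fun x : Sph n => V x :=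
  continuous_iff_continuousAt.2 fun x =>
    ((h.hasGradientAt x (ne_zero_of_mem_unit_sphere x)).hasFDerivAt.continuousAt).comp
      continuous_subtype_val.continuousAt

end IsSphericalJet

theorem sum_sq_inner_pd_incl (y q : Sph n) :
    ∑ i, inner ℝ (pd incl y i) (q : Ambient n) ^ 2 =
      1 - inner ℝ (y : Ambient n) (q : Ambient n) ^ 2 := by
  set s := inner ℝ (y : Ambient n) (q : Ambient n) with hs
  set w : Ambient n := q - s • (y : Ambient n) with hw
  have hw0 : inner ℝ w (y : Ambient n) = 0 := by
    rw [hw, inner_sub_left, real_inner_smul_left, inner_self_sph, real_inner_comm]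
    simp [hs]
  have h1 := sum_inner_pd_incl_mul y hw0 hw0
  have hi : ∀ i, inner ℝ (pd incl y i) w = inner ℝ (pd incl y i) (q : Ambient n) := fun i => by
    rw [hw, inner_sub_right, real_inner_smul_right, inner_pd_incl_self]
    simp
  simp only [hi, ← sq] at h1
  have h2 : inner ℝ w w = inner ℝ w (q : Ambient n) := by
    conv_lhs => rw [hw, inner_sub_right, real_inner_smul_right, ← hw, hw0, mul_zero, sub_zero]
  rw [h1, h2, hw, inner_sub_left, real_inner_smul_left, inner_self_sph, ← hs]
  ring

namespace IsSphericalJet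

variable {V : Ambient n → ℝ} {G : Ambient n → Ambient n} {A : Ambient n → Ambient n →L[ℝ] Ambient n}

theorem le_sphLaplacian_of_isMin (h : IsSphericalJet V G A) {ε a : ℝ} {q y : Sph n}
    (hmin : ∀ x : Sph n, V y - ε * Real.exp (a * inner ℝ (y : Ambient n) (q : Ambient n)) ≤
      V x - ε * Real.exp (a * inner ℝ (x : Ambient n) (q : Ambient n))) :
    ε * Real.exp (a * inner ℝ (y : Ambient n) (q : Ambient n)) *
        (a ^ 2 * (1 - inner ℝ (y : Ambient n) (q : Ambient n) ^ 2) -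
          n * (a * inner ℝ (y : Ambient n) (q : Ambient n))) ≤ sphLaplacian A y := by
  refine le_trans (le_of_eq ?_)
    (Finset.sum_le_sum fun i (_ : i ∈ Finset.univ) => (h.of_isMin_sub_exp hmin i).2)
  rw [← Finset.mul_sum, Finset.sum_sub_distrib, ← Finset.mul_sum, sum_sq_inner_pd_incl]
  simp

theorem norm_le_of_isMin (h : IsSphericalJet V G A) {ε a : ℝ} {q y : Sph n} (hε : 0 ≤ ε)
    (ha : 0 ≤ a)
    (hmin : ∀ x : Sph n, V y - ε * Real.exp (a * inner ℝ (y : Ambient n) (q : Ambient n)) ≤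
      V x - ε * Real.exp (a * inner ℝ (x : Ambient n) (q : Ambient n))) :
    ‖G y‖ ≤ ε * Real.exp (a * inner ℝ (y : Ambient n) (q : Ambient n)) * a := by
  set s := inner ℝ (y : Ambient n) (q : Ambient n) with hs
  set K := ε * Real.exp (a * s) * a with hK
  have hK0 : 0 ≤ K := by positivity
  have h1 := sum_inner_pd_incl_mul y (h.inner_eq_zero y) (h.inner_eq_zero y)
  rw [real_inner_self_eq_norm_sq] at h1
  have h2 : ∀ i, inner ℝ (pd incl y i) (G y) = K * inner ℝ (pd incl y i) (q : Ambient n) :=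
    fun i => by rw [real_inner_comm]; exact (h.of_isMin_sub_exp hmin i).1
  have h3 : ‖G y‖ ^ 2 = K ^ 2 * (1 - s ^ 2) := by
    rw [← h1, hs, ← sum_sq_inner_pd_incl, Finset.mul_sum]
    exact Finset.sum_congr rfl fun i _ => by rw [h2]; ring
  refine (abs_le_of_sq_le_sq' ?_ hK0).2
  rw [h3]
  nlinarith [mul_nonneg (sq_nonneg K) (sq_nonneg s)]

end IsSphericalJet

/-! ### The strong minimum principle on the sphere -/

theorem exists_sph_inner_eq_zero (hn : 1 ≤ n) (z : Sph n) :
    ∃ q : Sph n, inner ℝ (z : Ambient n) (q : Ambient n) = 0 :=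
  ⟨⟨pd incl z ⟨0, hn⟩, by
    have := inner_pd_incl_pd_incl z ⟨0, hn⟩ ⟨0, hn⟩
    rw [if_pos rfl, real_inner_self_eq_norm_sq] at this
    rw [mem_sphere_zero_iff_norm]
    nlinarith [norm_nonneg (pd incl z ⟨0, hn⟩)]⟩,
    by rw [real_inner_comm]; exact inner_pd_incl_self z _⟩

/-- The strong minimum principle for `Δ - C |∇| - C`. If `V` has both zeros and positive values,
then a barrier `h = exp (a ⟨·, q⟩) - exp (a s₀)`, positive exactly on a cap without zeros of `V` in
its interior but with one on its boundary, is compared with `V`. For small `ε`, a global minimiser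
of `V - ε h` on the whole sphere has to lie in the part of the cap where `h` is a strict
subsolution, which contradicts the conditions at a minimum. -/
theorem IsSphericalJet.eq_zero_or_pos {V : Ambient n → ℝ} {G : Ambient n → Ambient n}
    {A : Ambient n → Ambient n →L[ℝ] Ambient n} (hn : 1 ≤ n) (h : IsSphericalJet V G A)
    (hV : ∀ x : Sph n, 0 ≤ V x) {C : ℝ} (hC : 0 ≤ C)
    (hL : ∀ x : Sph n, sphLaplacian A x ≤ C * (V x + ‖G x‖)) :
    (∀ x : Sph n, V x = 0) ∨ ∀ x : Sph n, 0 < V x := by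
  by_contra! hcon
  obtain ⟨⟨p, hp⟩, z, hz⟩ := hcon
  have hz : V z = 0 := le_antisymm hz (hV z)
  -- a pole `q` outside the zero set and a zero `z` that is not its antipode
  obtain ⟨q, hq, z, hz, hzq⟩ : ∃ q : Sph n, V q ≠ 0 ∧ ∃ z : Sph n, V z = 0 ∧
      -1 < inner ℝ (z : Ambient n) (q : Ambient n) := by
    have hge : ∀ a b : Sph n, -1 ≤ inner ℝ (a : Ambient n) (b : Ambient n) := fun a b =>
      neg_one_le_real_inner_of_norm_eq_one (norm_eq_of_mem_sphere a) (norm_eq_of_mem_sphere b)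
    rcases (hge z p).lt_or_eq with hlt | heq
    · exact ⟨p, hp, z, hz, hlt⟩
    have hpz : (z : Ambient n) = -p := by
      refine (inner_eq_neg_one_iff_of_norm_eq_one (norm_eq_of_mem_sphere z)
        (norm_eq_of_mem_sphere p)).1 heq.symm
    obtain ⟨q, hq⟩ := exists_sph_inner_eq_zero hn z
    by_cases h0 : V q = 0
    · refine ⟨p, hp, q, h0, ?_⟩
      rw [hpz, inner_neg_left, real_inner_comm] at hq
      linarith
    · exact ⟨q, h0, z, hz, by rw [hq]; norm_num⟩
  have hcont := h.continuous_sph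
  have hφc : Continuous fun x : Sph n => inner ℝ (x : Ambient n) (q : Ambient n) := by fun_prop
  -- the zero set lies in `{⟨·, q⟩ ≤ s₀}` and touches the boundary of this set at `x₀`
  obtain ⟨x₀, hx₀, hmax⟩ : ∃ x₀ ∈ {x : Sph n | V x = 0}, ∀ x ∈ {x : Sph n | V x = 0},
      inner ℝ (x : Ambient n) (q : Ambient n) ≤ inner ℝ (x₀ : Ambient n) (q : Ambient n) :=
    (isClosed_eq hcont continuous_const).isCompact.exists_isMaxOn ⟨z, hz⟩ hφc.continuousOn
  set s₀ := inner ℝ (x₀ : Ambient n) (q : Ambient n) with hs₀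
  have hs₀_gt : -1 < s₀ := hzq.trans_le (hmax z hz)
  have hle : ∀ a : Sph n, inner ℝ (a : Ambient n) (q : Ambient n) ≤ 1 := fun a =>
    real_inner_le_one_of_norm_eq_one (norm_eq_of_mem_sphere a) (norm_eq_of_mem_sphere q)
  have hs₀_lt : s₀ < 1 := by
    refine (hle x₀).lt_of_ne fun h1 => hq ?_
    have : x₀ = q := (sphere_ext_iff x₀ q).2 h1
    rw [← this]; exact hx₀
  set s₁ := (1 + s₀) / 2 with hs₁
  -- `V` is bounded below by `m > 0` on the cap `{s₁ ≤ ⟨·, q⟩}`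
  obtain ⟨m, hm, hmV⟩ : ∃ m, 0 < m ∧ ∀ x : Sph n, s₁ ≤ inner ℝ (x : Ambient n) (q : Ambient n) →
      m ≤ V x := by
    obtain ⟨w, hw, hwmin⟩ := (isClosed_le continuous_const hφc).isCompact.exists_isMinOn
      (s := {x : Sph n | s₁ ≤ inner ℝ (x : Ambient n) (q : Ambient n)})
      ⟨q, by simp only [mem_ofPred_eq, inner_self_sph]; linarith⟩ hcont.continuousOn
    refine ⟨V w, (hV w).lt_of_ne fun h0 => ?_, fun x hx => hwmin hx⟩
    have h1 := hmax w h0.symm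
    have h2 : s₁ ≤ inner ℝ (w : Ambient n) (q : Ambient n) := hw
    linarith
  set δ := (1 - s₁) * (1 + s₀) with hδ
  have hδ0 : 0 < δ := mul_pos (by linarith) (by linarith)
  -- the exponent for which the barrier is a strict subsolution where `s₀ ≤ ⟨·, q⟩ ≤ s₁`
  set a := 1 + (n + 2 * C) / δ with ha
  have ha1 : 1 ≤ a := by
    have : 0 ≤ (n + 2 * C) / δ := by positivity
    linarith
  have haδ : n + 2 * C < a * δ := by
    rw [ha, add_mul, div_mul_cancel₀ _ hδ0.ne']
    linarith
  set ε := m / (2 * Real.exp a) with hε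
  have hε0 : 0 < ε := by positivity
  have hεm : ε * Real.exp a < m := by
    rw [hε]; field_simp; norm_num
  obtain ⟨y, hy⟩ : ∃ y : Sph n, ∀ x : Sph n,
      V y - ε * Real.exp (a * inner ℝ (y : Ambient n) (q : Ambient n)) ≤
        V x - ε * Real.exp (a * inner ℝ (x : Ambient n) (q : Ambient n)) := by
    obtain ⟨y, -, hy⟩ := isCompact_univ.exists_isMinOn (s := (univ : Set (Sph n))) ⟨q, mem_univ q⟩
      (f := fun x : Sph n => V x - ε * Real.exp (a * inner ℝ (x : Ambient n) (q : Ambient n)))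
      (hcont.sub (by fun_prop)).continuousOn
    exact ⟨y, fun x => hy (mem_univ x)⟩
  set s := inner ℝ (y : Ambient n) (q : Ambient n) with hs
  set E := Real.exp (a * s) with hE
  have hE0 : 0 < E := Real.exp_pos _
  have hy0 : V y - ε * E ≤ -(ε * Real.exp (a * s₀)) := by
    have := hy x₀
    rw [show V x₀ = 0 from hx₀, ← hs₀] at this
    linarith
  have hVy := hV y
  -- outside the cap the barrier is negative while `V ≥ 0`
  have hss₀ : s₀ ≤ s := by
    by_contra! hlt
    have : E < Real.exp (a * s₀) := Real.exp_lt_exp.2 (by nlinarith)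
    nlinarith
  -- near the pole `q`, `V` exceeds the barrier by the choice of `ε`
  have hss₁ : s < s₁ := by
    by_contra! hge
    have h1 := hmV y hge
    have h2 : E ≤ Real.exp a := Real.exp_le_exp.2 (by nlinarith [hle y])
    have h3 : 0 < ε * Real.exp (a * s₀) := by positivity
    nlinarith
  have hVE : V y ≤ ε * E := by
    have h3 : 0 < ε * Real.exp (a * s₀) := by positivity
    linarith
  have hlap : ε * E * (a ^ 2 * (1 - s ^ 2) - n * (a * s)) ≤ sphLaplacian A y :=
    h.le_sphLaplacian_of_isMin hy
  have hgrad : ‖G y‖ ≤ ε * E * a := h.norm_le_of_isMin hε0.le (by linarith) hy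
  have hfin : ε * E * (a ^ 2 * (1 - s ^ 2) - n * (a * s)) ≤ ε * E * (C * (1 + a)) := by
    refine hlap.trans ((hL y).trans ?_)
    have : C * (V y + ‖G y‖) ≤ C * (ε * E + ε * E * a) :=
      mul_le_mul_of_nonneg_left (add_le_add hVE hgrad) hC
    refine this.trans (le_of_eq ?_)
    ring
  have hfin' := le_of_mul_le_mul_left hfin (by positivity)
  have hs1 : s ≤ 1 := hle y
  have hδs : δ ≤ 1 - s ^ 2 := by
    have : (1 - s₁) * (1 + s₀) ≤ (1 - s) * (1 + s) :=
      mul_le_mul (by linarith) (by linarith) (by linarith) (by linarith)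
    linear_combination this
  have h4 : (n : ℝ) * (a * s) ≤ n * a :=
    mul_le_mul_of_nonneg_left (mul_le_of_le_one_right (by linarith) hs1) n.cast_nonneg
  have h5 : a ^ 2 * δ ≤ a ^ 2 * (1 - s ^ 2) := mul_le_mul_of_nonneg_left hδs (sq_nonneg a)
  have h6 : C * (1 + a) ≤ C * (2 * a) := mul_le_mul_of_nonneg_left (by linarith) hC
  have h7 : (n + 2 * C) * a < a * δ * a := mul_lt_mul_of_pos_right haδ (by linarith)
  linarith

/-! ### Extension of functions on the sphere constantly along rays -/

open Classical in
/-- The extension of a function on the sphere to `ℝⁿ⁺¹ ∖ {0}` that is constant along rays (with the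
value `0` at the origin). -/
noncomputable def radialExt (f : Sph n → ℝ) (z : Ambient n) : ℝ :=
  if h : z ≠ 0 then f ⟨‖z‖⁻¹ • z, by simp [norm_smul, h]⟩ else 0

theorem radialExt_coe (f : Sph n → ℝ) (x : Sph n) : radialExt f x = f x := by
  rw [radialExt, dif_pos (ne_zero_of_mem_unit_sphere x)]
  congr 1
  ext1
  simp

theorem radialExt_smul (f : Sph n → ℝ) {c : ℝ} (hc : 0 < c) (z : Ambient n) :
    radialExt f (c • z) = radialExt f z := by
  by_cases hz : z = 0
  · simp [hz]
  have hcz : c • z ≠ 0 := smul_ne_zero hc.ne' hz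
  rw [radialExt, radialExt, dif_pos hz, dif_pos hcz]
  congr 2
  rw [norm_smul, smul_smul, Real.norm_of_nonneg hc.le]
  congr 1
  field_simp

/-- The extension is the composition of `f` with the normalisation map from the open submanifold
`ℝⁿ⁺¹ ∖ {0}` to the sphere. -/
theorem contDiffAt_radialExt {f : Sph n → ℝ} (hf : ContMDiff (𝓡 n) 𝓘(ℝ, ℝ) 2 f) {z : Ambient n}
    (hz : z ≠ 0) : ContDiffAt ℝ 2 (radialExt f) z := by
  have : Fact (Module.finrank ℝ (Ambient n) = n + 1) :=
    Fact.mk (@finrank_euclideanSpace_fin ℝ _ (n + 1))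
  let Ω : TopologicalSpace.Opens (Ambient n) := ⟨{0}ᶜ, isOpen_compl_singleton⟩
  have hΩ : ∀ w : Ω, (w : Ambient n) ≠ 0 := fun w => w.2
  have h1 : ContMDiff 𝓘(ℝ, Ambient n) 𝓘(ℝ, Ambient n) 2
      fun w : Ω => ‖(w : Ambient n)‖⁻¹ • (w : Ambient n) := by
    intro w
    have h0 : ContDiffAt ℝ 2 (fun v : Ambient n => ‖v‖⁻¹ • v) w :=
      ((contDiffAt_norm ℝ (hΩ w)).inv (norm_ne_zero_iff.2 (hΩ w))).smul contDiffAt_id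
    exact contMDiffAt_subtype_iff.2 h0.contMDiffAt
  have h2 := h1.codRestrict_sphere (n := n) fun w => by simp [norm_smul, hΩ w]
  have h3 := hf.comp h2
  have h4 : ContMDiffAt 𝓘(ℝ, Ambient n) 𝓘(ℝ, ℝ) 2 (radialExt f) ((⟨z, hz⟩ : Ω) : Ambient n) := by
    refine contMDiffAt_subtype_iff.1 ?_
    convert! h3 ⟨z, hz⟩ using 1
    ext w
    rw [radialExt, dif_pos (hΩ w)]
    rfl
  exact contMDiffAt_iff_contDiffAt.1 h4

theorem isSphericalJet_radialExt {f : Sph n → ℝ} (hf : ContMDiff (𝓡 n) 𝓘(ℝ, ℝ) 2 f) :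
    IsSphericalJet (radialExt f) (gradient (radialExt f)) (fderiv ℝ (gradient (radialExt f))) where
  hasGradientAt z hz :=
    ((contDiffAt_radialExt hf hz).differentiableAt two_ne_zero).hasGradientAt
  hasFDerivAt x := by
    have h := contDiffAt_radialExt hf (ne_zero_of_mem_unit_sphere x)
    have h1 : DifferentiableAt ℝ (fderiv ℝ (radialExt f)) (x : Ambient n) :=
      (h.fderiv_right (m := 1) (by norm_num)).differentiableAt one_ne_zero
    exact (((InnerProductSpace.toDual ℝ (Ambient n)).symm.toContinuousLinearEquiv
      |>.differentiableAt).comp _ h1).hasFDerivAt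
  inner_eq_zero z := by
    by_cases hz : z = 0
    · simp [hz]
    have hd := ((contDiffAt_radialExt hf hz).differentiableAt two_ne_zero).hasGradientAt.hasFDerivAt
    have hc : HasDerivAt (fun s : ℝ => s • z) z 1 := by
      have := (hasDerivAt_id (1 : ℝ)).smul_const z
      rwa [one_smul] at this
    have hd' : HasFDerivAt (radialExt f)
        (InnerProductSpace.toDual ℝ (Ambient n) (gradient (radialExt f) z)) ((1 : ℝ) • z) := by rw [one_smul]; exact hd
    have h1 := hd'.comp_hasDerivAt 1 hc
    have h2 : HasDerivAt (radialExt f ∘ fun s : ℝ => s • z) 0 1 := by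
      refine (hasDerivAt_const (1 : ℝ) (radialExt f z)).congr_of_eventuallyEq ?_
      filter_upwards [lt_mem_nhds (zero_lt_one : (0 : ℝ) < 1)] with s hs
      exact radialExt_smul f hs z
    simpa using h1.unique h2

theorem inner_fderiv_gradient_radialExt_comm {f : Sph n → ℝ} (hf : ContMDiff (𝓡 n) 𝓘(ℝ, ℝ) 2 f)
    (x : Sph n) (s t : Ambient n) :
    inner ℝ (fderiv ℝ (gradient (radialExt f)) x s) t =
      inner ℝ (fderiv ℝ (gradient (radialExt f)) x t) s := by
  have h := contDiffAt_radialExt hf (ne_zero_of_mem_unit_sphere x)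
  have h1 : DifferentiableAt ℝ (fderiv ℝ (radialExt f)) (x : Ambient n) :=
    (h.fderiv_right (m := 1) (by norm_num)).differentiableAt one_ne_zero
  have hsymm : IsSymmSndFDerivAt ℝ (radialExt f) (x : Ambient n) :=
    h.isSymmSndFDerivAt (by simp)
  have key : ∀ s t, inner ℝ (fderiv ℝ (gradient (radialExt f)) x s) t =
      fderiv ℝ (fderiv ℝ (radialExt f)) x s t := fun s t => by
    have h2 : HasFDerivAt (gradient (radialExt f)) _ (x : Ambient n) :=
      (InnerProductSpace.toDual ℝ (Ambient n)).symm.toContinuousLinearEquiv.hasFDerivAt.comp _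
        h1.hasFDerivAt
    rw [h2.fderiv]
    exact InnerProductSpace.toDual_symm_apply
  rw [key, key]
  exact hsymm s t

/-- Coordinate derivatives on the sphere of the restriction of an ambient function. -/
theorem pd_comp_coe {F : Type} [NormedAddCommGroup F] [NormedSpace ℝ F] {Φ : Ambient n → F}
    {x : Sph n} (hΦ : DifferentiableAt ℝ Φ x) (i : Fin n) :
    pd (fun y : Sph n => Φ y) x i = fderiv ℝ Φ x (pd incl x i) := by
  have : Fact (Module.finrank ℝ (Ambient n) = n + 1) :=
    Fact.mk (@finrank_euclideanSpace_fin ℝ _ (n + 1))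
  have hmd : MDifferentiableAt (𝓡 n) 𝓘(ℝ, Ambient n) (incl : Sph n → Ambient n) x :=
    (contMDiff_coe_sphere (m := 1) (E := Ambient n) (n := n) x).mdifferentiableAt one_ne_zero
  have h := mfderiv_comp (I := 𝓡 n) (I' := 𝓘(ℝ, Ambient n)) (I'' := 𝓘(ℝ, F)) (g := Φ) x
    hΦ.mdifferentiableAt hmd
  unfold pd
  rw [← mfderiv_eq_fderiv]
  exact congr($h (EuclideanSpace.single i 1))

/-! ### The intensity form in terms of the logarithm of the radial function -/

section Intensity

variable {ρ : Sph n → ℝ}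

/-- The logarithm of a radial function, extended to `ℝⁿ⁺¹ ∖ {0}` constantly along rays. -/
noncomputable def logExt (ρ : Sph n → ℝ) : Ambient n → ℝ :=
  radialExt fun x => Real.log (ρ x)

theorem IsRadialFunction.contMDiff_log (hρ : IsRadialFunction ρ) :
    ContMDiff (𝓡 n) 𝓘(ℝ, ℝ) 2 fun x => Real.log (ρ x) := fun x =>
  (Real.contDiffAt_log.2 (hρ.2 x).ne').contMDiffAt.comp x (hρ.1 x)

theorem logExt_coe (ρ : Sph n → ℝ) (x : Sph n) : logExt ρ x = Real.log (ρ x) := radialExt_coe _ x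

theorem IsRadialFunction.isSphericalJet (hρ : IsRadialFunction ρ) :
    IsSphericalJet (logExt ρ) (gradient (logExt ρ)) (fderiv ℝ (gradient (logExt ρ))) :=
  isSphericalJet_radialExt hρ.contMDiff_log

theorem IsRadialFunction.exp_logExt (hρ : IsRadialFunction ρ) :
    ρ = fun x : Sph n => Real.exp (logExt ρ x) := by
  ext x
  rw [logExt_coe, Real.exp_log (hρ.2 x)]

theorem IsRadialFunction.hasFDerivAt_exp (hρ : IsRadialFunction ρ) (x : Sph n) :
    HasFDerivAt (fun z => Real.exp (logExt ρ z))
      (ρ x • InnerProductSpace.toDual ℝ (Ambient n) (gradient (logExt ρ) x)) (x : Ambient n) := by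
  have := (hρ.isSphericalJet.hasGradientAt x (ne_zero_of_mem_unit_sphere x)).hasFDerivAt.exp
  rwa [logExt_coe, Real.exp_log (hρ.2 x)] at this

theorem IsRadialFunction.grad_eq (hρ : IsRadialFunction ρ) (x : Sph n) :
    grad ρ x = ρ x • gradient (logExt ρ) x := by
  have hpd : ∀ i, pd ρ x i = ρ x * inner ℝ (pd incl x i) (gradient (logExt ρ) x) := fun i => by
    conv_lhs => rw [hρ.exp_logExt]
    rw [pd_comp_coe (hρ.hasFDerivAt_exp x).differentiableAt, (hρ.hasFDerivAt_exp x).fderiv]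
    simp
  rw [grad, metricE_eq_one, inv_one]
  conv_rhs => rw [← sum_inner_pd_incl_smul x (hρ.isSphericalJet.inner_eq_zero x), Finset.smul_sum]
  refine Finset.sum_congr rfl fun i _ => ?_
  rw [Finset.sum_eq_single i]
  · rw [Matrix.one_apply_eq, one_mul, hpd, mul_smul]
  · intro j _ hj
    rw [Matrix.one_apply_ne' hj]
    simp
  · simp

theorem IsRadialFunction.pd_position (hρ : IsRadialFunction ρ) (x : Sph n) (i : Fin n) :
    pd (position ρ) x i =
      ρ x • (inner ℝ (gradient (logExt ρ) x) (pd incl x i) • (x : Ambient n) + pd incl x i) := by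
  have h1 : position ρ = fun y : Sph n => Real.exp (logExt ρ y) • (y : Ambient n) := by
    ext1 y
    rw [position, logExt_coe, Real.exp_log (hρ.2 y)]
    rfl
  have h2 := (hρ.hasFDerivAt_exp x).smul (hasFDerivAt_id (x : Ambient n))
  rw [h1, pd_comp_coe (Φ := fun z => Real.exp (logExt ρ z) • z) h2.differentiableAt]
  erw [h2.fderiv]
  simp only [logExt_coe, Real.exp_log (hρ.2 x)]
  simp [smul_smul]
  abel

/-- With `p = ∇ log ρ`, the normal is `(x - p) / √(1 + |p|²)`. -/
theorem IsRadialFunction.reflect_eq (hρ : IsRadialFunction ρ) (x : Sph n) :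
    reflect ρ x = (x : Ambient n) - (2 / (1 + ‖gradient (logExt ρ) x‖ ^ 2)) •
      ((x : Ambient n) - gradient (logExt ρ) x) := by
  set p := gradient (logExt ρ) x with hp
  have hρ0 := hρ.2 x
  have hpx : inner ℝ (x : Ambient n) p = 0 := by
    rw [real_inner_comm]; exact hρ.isSphericalJet.inner_eq_zero x
  have hN : unitNormal ρ x =
      ((√(ρ x ^ 2 + ‖grad ρ x‖ ^ 2))⁻¹ * ρ x) • ((x : Ambient n) - p) := by
    rw [unitNormal, mul_smul, hρ.grad_eq, smul_sub (ρ x)]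
    rfl
  have hsq : ((√(ρ x ^ 2 + ‖grad ρ x‖ ^ 2))⁻¹ * ρ x) ^ 2 = 1 / (1 + ‖p‖ ^ 2) := by
    rw [mul_pow, inv_pow, Real.sq_sqrt (by positivity), hρ.grad_eq, norm_smul,
      Real.norm_of_nonneg hρ0.le, ← hp]
    field_simp
  rw [reflect, hN]
  generalize (√(ρ x ^ 2 + ‖grad ρ x‖ ^ 2))⁻¹ * ρ x = k at hsq
  have hin : inner ℝ (incl x) (k • ((x : Ambient n) - p)) = k := by
    rw [real_inner_smul_right, inner_sub_right]
    change k * (inner ℝ (x : Ambient n) (x : Ambient n) - inner ℝ (x : Ambient n) p) = k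
    rw [inner_self_sph, hpx]; ring
  rw [hin, smul_smul, show 2 * k * k = 2 / (1 + ‖p‖ ^ 2) by rw [mul_assoc, ← sq, hsq]; ring]
  rfl

/-- In the orthonormal coordinate frame at `x`, with `u = log ρ` and `b = 2 / (1 + |∇u|²)`:
`κᵢⱼ = b (uᵢ uⱼ - ∇ᵢⱼ u + δᵢⱼ) - δᵢⱼ`. The derivative `β` of `b` cancels. -/
theorem IsRadialFunction.intensityForm_eq (hρ : IsRadialFunction ρ) (x : Sph n) (i j : Fin n) :
    intensityForm ρ x i j = 2 / (1 + ‖gradient (logExt ρ) x‖ ^ 2) *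
      (inner ℝ (gradient (logExt ρ) x) (pd incl x i) *
          inner ℝ (gradient (logExt ρ) x) (pd incl x j) -
        inner ℝ (pd incl x i) (fderiv ℝ (gradient (logExt ρ)) x (pd incl x j)) +
        if i = j then 1 else 0) - if i = j then 1 else 0 := by
  have hJ := hρ.isSphericalJet
  have hG := hJ.hasFDerivAt x
  set p := gradient (logExt ρ) x with hp
  set A := fderiv ℝ (gradient (logExt ρ)) x with hA
  have hw : DifferentiableAt ℝ (fun z => 1 + ‖gradient (logExt ρ) z‖ ^ 2) (x : Ambient n) :=
    (differentiableAt_const (1 : ℝ)).add (hG.differentiableAt.norm_sq ℝ)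
  have hb : DifferentiableAt ℝ (fun z => 2 / (1 + ‖gradient (logExt ρ) z‖ ^ 2)) (x : Ambient n) := by
    simp only [div_eq_mul_inv]
    refine (hw.fun_inv ?_).const_mul 2
    positivity
  have hΓ := (hasFDerivAt_id (x : Ambient n)).sub
    (hb.hasFDerivAt.smul ((hasFDerivAt_id (x : Ambient n)).sub hG))
  set β := fderiv ℝ (fun z => 2 / (1 + ‖gradient (logExt ρ) z‖ ^ 2)) (x : Ambient n)
    (pd incl x j) with hβ
  have hpd : pd (reflect ρ) x j = pd incl x j - ((2 / (1 + ‖p‖ ^ 2)) •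
      (pd incl x j - A (pd incl x j)) + β • ((x : Ambient n) - p)) := by
    have h1 : reflect ρ = fun y : Sph n => ((y : Ambient n) -
        (2 / (1 + ‖gradient (logExt ρ) y‖ ^ 2)) • ((y : Ambient n) - gradient (logExt ρ) y)) :=
      funext hρ.reflect_eq
    rw [h1, pd_comp_coe (Φ := fun z => z - (2 / (1 + ‖gradient (logExt ρ) z‖ ^ 2)) •
      (z - gradient (logExt ρ) z)) hΓ.differentiableAt]
    exact congr($(hΓ.fderiv) (pd incl x j))
  rw [intensityForm, Matrix.of_apply, hρ.pd_position, hpd]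
  have hAx := hJ.inner_apply_self x (pd incl x j)
  have hpx := hJ.inner_eq_zero x
  have hρ0 := (hρ.2 x).ne'
  rw [← hp] at hAx hpx
  rw [← hA] at hAx
  simp only [real_inner_smul_left, inner_add_left, inner_sub_right, inner_add_right,
    real_inner_smul_right, inner_self_sph, real_inner_comm _ (x : Ambient n), inner_pd_incl_self,
    hAx, hpx, inner_pd_incl_pd_incl]
  rw [← hp, real_inner_comm p (pd incl x i)]
  generalize 2 / (1 + ‖p‖ ^ 2) = b
  rw [div_eq_iff hρ0]
  ring

theorem IsRadialFunction.isHermitian_intensityForm (hρ : IsRadialFunction ρ) (x : Sph n) :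
    (intensityForm ρ x).IsHermitian := by
  ext i j
  rw [Matrix.conjTranspose_apply, star_trivial, hρ.intensityForm_eq, hρ.intensityForm_eq]
  rw [real_inner_comm _ (pd incl x j), real_inner_comm _ (pd incl x i)]
  rw [show inner ℝ (fderiv ℝ (gradient (logExt ρ)) x (pd incl x i)) (pd incl x j) =
    inner ℝ (fderiv ℝ (gradient (logExt ρ)) x (pd incl x j)) (pd incl x i) from
    inner_fderiv_gradient_radialExt_comm hρ.contMDiff_log x _ _]
  simp only [eq_comm (a := i)]
  ring

/-- The intensity form being symmetric, its characteristic polynomial splits over `ℝ`, so that the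
sum of the principal intensities is the trace. -/
theorem IsRadialFunction.intensityS_one_eq (hρ : IsRadialFunction ρ) (x : Sph n) :
    intensityS 1 ρ x = 2 / (1 + ‖gradient (logExt ρ) x‖ ^ 2) *
      (‖gradient (logExt ρ) x‖ ^ 2 - sphLaplacian (fderiv ℝ (gradient (logExt ρ))) x + n) - n := by
  rw [intensityS, principalIntensities, metricE_eq_one, inv_one, one_mul]
  have h1 : ∀ s : Multiset ℝ, s.esymm 1 = s.sum := fun s => by
    simp [Multiset.esymm, Multiset.powersetCard_one]
  rw [h1, ← Matrix.trace_eq_sum_roots_charpoly_of_splits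
    (hρ.isHermitian_intensityForm x).splits_charpoly, Matrix.trace]
  simp only [Matrix.diag_apply, hρ.intensityForm_eq, if_true]
  have h2 := sum_inner_pd_incl_mul x (hρ.isSphericalJet.inner_eq_zero x)
    (hρ.isSphericalJet.inner_eq_zero x)
  rw [real_inner_self_eq_norm_sq] at h2
  rw [Finset.sum_sub_distrib, ← Finset.mul_sum, Finset.sum_add_distrib, Finset.sum_sub_distrib,
    ← h2, sphLaplacian]
  simp

end Intensity

/-! ### Restriction of functions on the annulus to rays -/

section RadialRestriction

variable {R₁ R₂ : ℝ} {α : ℝ≥0} {g : Ambient n → ℝ}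

theorem smul_mem_annulus (hR₁ : 0 < R₁) (x : Sph n) {t : ℝ} (ht : t ∈ Icc R₁ R₂) :
    t • (x : Ambient n) ∈ annulus n R₁ R₂ := by
  have : ‖t • (x : Ambient n)‖ = t := by
    rw [norm_smul, norm_eq_of_mem_sphere x, mul_one, Real.norm_of_nonneg (hR₁.le.trans ht.1)]
  rw [annulus, mem_ofPred_eq, this]
  exact ht

theorem isCompact_annulus : IsCompact (annulus n R₁ R₂) := by
  refine (isCompact_closedBall (0 : Ambient n) R₂).of_isClosed_subset ?_ fun y hy => ?_
  · exact (isClosed_le continuous_const continuous_norm).inter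
      (isClosed_le continuous_norm continuous_const)
  · simpa using hy.2

theorem IsC1Holder.hasDerivWithinAt (hg : IsC1Holder α g (annulus n R₁ R₂)) (hR₁ : 0 < R₁)
    (x : Sph n) {t : ℝ} (ht : t ∈ Icc R₁ R₂) :
    HasDerivWithinAt (fun s : ℝ => g (s • (x : Ambient n)))
      (fderivWithin ℝ g (annulus n R₁ R₂) (t • (x : Ambient n)) x) (Icc R₁ R₂) t := by
  have h1 : HasDerivWithinAt (fun s : ℝ => s • (x : Ambient n)) x (Icc R₁ R₂) t := by
    have := ((hasDerivAt_id t).smul_const (x : Ambient n)).hasDerivWithinAt (s := Icc R₁ R₂)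
    rwa [one_smul] at this
  have h2 := (hg.1.differentiableOn one_ne_zero _ (smul_mem_annulus hR₁ x ht)).hasFDerivWithinAt
  exact h2.comp_hasDerivWithinAt t h1 fun s hs => smul_mem_annulus hR₁ x hs

/-- The Lipschitz constant is uniform over all rays: it bounds the differential of `g`, which is
continuous on the compact annulus. -/
theorem IsC1Holder.exists_lipschitz_radial (hg : IsC1Holder α g (annulus n R₁ R₂)) (hα : 0 < α)
    (hR₁ : 0 < R₁) : ∃ L, 0 ≤ L ∧ ∀ x : Sph n, ∀ s ∈ Icc R₁ R₂, ∀ t ∈ Icc R₁ R₂,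
      |g (s • (x : Ambient n)) - g (t • (x : Ambient n))| ≤ L * |s - t| := by
  obtain ⟨K, hK⟩ := hg.2
  obtain ⟨L, hL⟩ := isCompact_annulus.exists_bound_of_continuousOn
    (hK.uniformContinuousOn hα).continuousOn
  refine ⟨max L 0, le_max_right _ _, fun x s hs t ht => ?_⟩
  refine (convex_Icc R₁ R₂).norm_image_sub_le_of_norm_hasDerivWithin_le
    (fun r hr => hg.hasDerivWithinAt hR₁ x hr) (fun r hr => ?_) ht hs
  refine (ContinuousLinearMap.le_opNorm _ _).trans ?_
  rw [norm_eq_of_mem_sphere x, mul_one]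
  exact (hL _ (smul_mem_annulus hR₁ x hr)).trans (le_max_left _ _)

theorem IsC1Holder.antitoneOn_radial (hg : IsC1Holder α g (annulus n R₁ R₂)) (hR₁ : 0 < R₁)
    {x : Sph n} (hx : ∀ t ∈ Icc R₁ R₂,
      derivWithin (fun s : ℝ => g (s • (x : Ambient n))) (Icc R₁ R₂) t ≤ 0) :
    AntitoneOn (fun s : ℝ => g (s • (x : Ambient n))) (Icc R₁ R₂) := by
  have hd : DifferentiableOn ℝ (fun s : ℝ => g (s • (x : Ambient n))) (Icc R₁ R₂) :=
    fun t ht => (hg.hasDerivWithinAt hR₁ x ht).differentiableWithinAt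
  refine antitoneOn_of_deriv_nonpos (convex_Icc R₁ R₂) hd.continuousOn
    (hd.mono interior_subset) fun t ht => ?_
  rw [← derivWithin_of_mem_nhds (mem_interior_iff_mem_nhds.1 ht)]
  exact hx t (interior_subset ht)

end RadialRestriction

theorem IsSphericalJet.exists_norm_le {V : Ambient n → ℝ} {G : Ambient n → Ambient n}
    {A : Ambient n → Ambient n →L[ℝ] Ambient n} (h : IsSphericalJet V G A) :
    ∃ P, 0 ≤ P ∧ ∀ x : Sph n, ‖G x‖ ≤ P := by
  have hc : Continuous fun x : Sph n => G x := continuous_iff_continuousAt.2 fun x =>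
    (h.hasFDerivAt x).continuousAt.comp continuous_subtype_val.continuousAt
  obtain ⟨P, hP⟩ := isCompact_univ.exists_bound_of_continuousOn hc.continuousOn
  exact ⟨max P 0, le_max_right _ _, fun x => (hP x (mem_univ x)).trans (le_max_left _ _)⟩

/-! ### Comparison of solutions with spheres and with each other -/

section Solution

variable {R₁ R₂ : ℝ} {α : ℝ≥0} {g : Ambient n → ℝ} {ρ ρ₁ ρ₂ : Sph n → ℝ}

/-- The equation `S₁ = n g`, solved for the Laplacian of `log ρ`. -/
theorem IsSolution.sphLaplacian_eq (hρ : IsSolution R₁ R₂ g ρ) (x : Sph n) :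
    sphLaplacian (fderiv ℝ (gradient (logExt ρ))) x = ‖gradient (logExt ρ) x‖ ^ 2 + n -
      n / 2 * (1 + g (ρ x • (x : Ambient n))) * (1 + ‖gradient (logExt ρ) x‖ ^ 2) := by
  have h := hρ.2.2 x
  rw [hρ.1.intensityS_one_eq] at h
  have hw : 1 + ‖gradient (logExt ρ) x‖ ^ 2 ≠ 0 := by positivity
  field_simp at h
  linear_combination -h / 2

/-- The function `v = log (ρ / R₁) ≥ 0` satisfies `Δ v ≤ C v`: the hypothesis on the inner sphere
and the Lipschitz bound give `g ≥ 1 - O(v)`, and for `g = 1` the right-hand side of the equation is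
`-(n - 1) |∇v|² ≤ 0`. -/
theorem IsSolution.eq_inner_or_lt (hn : 1 ≤ n) (hα : 0 < α) (hR₁ : 0 < R₁)
    (hR₁₂ : R₁ < R₂) (hg : IsC1Holder α g (annulus n R₁ R₂))
    (hg_inner : ∀ x : Sph n, 1 ≤ g (R₁ • (x : Ambient n))) (hρ : IsSolution R₁ R₂ g ρ) :
    (∀ x, ρ x = R₁) ∨ ∀ x, R₁ < ρ x := by
  have hJ := hρ.1.isSphericalJet
  obtain ⟨L, hL0, hL⟩ := hg.exists_lipschitz_radial hα hR₁
  obtain ⟨P, hP0, hP⟩ := hJ.exists_norm_le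
  have hR₂ : 0 < R₂ := hR₁.trans hR₁₂
  have hn1 : (1 : ℝ) ≤ n := by exact_mod_cast hn
  have key := (hJ.const_add (-Real.log R₁)).eq_zero_or_pos hn (C := n * L * R₂ * (1 + P ^ 2))
    (fun x => ?_) ?_ fun x => ?_
  · simp only [logExt_coe] at key
    refine key.imp (fun h x => ?_) fun h x => ?_
    · exact Real.log_injOn_pos (hρ.1.2 x) hR₁ (by linarith [h x])
    · exact (Real.log_lt_log_iff hR₁ (hρ.1.2 x)).1 (by linarith [h x])
  · rw [logExt_coe]
    have := Real.log_le_log hR₁ (hρ.2.1 x).1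
    linarith
  · positivity
  · have hx := hρ.2.1 x
    rw [hρ.sphLaplacian_eq, logExt_coe]
    set v := -Real.log R₁ + Real.log (ρ x) with hv
    set p := ‖gradient (logExt ρ) x‖ with hp
    have hp0 : 0 ≤ p := norm_nonneg _
    have hpP : p ^ 2 ≤ P ^ 2 := pow_le_pow_left₀ hp0 (hP x) 2
    have hρ0 := hρ.1.2 x
    -- `1 - v ≤ exp (-v) = R₁ / ρ`
    have hρv : ρ x - R₁ ≤ R₂ * v := by
      have h1 := Real.add_one_le_exp (-v)
      have h2 : Real.exp (-v) = R₁ / ρ x := by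
        rw [hv, neg_add, neg_neg, Real.exp_add, Real.exp_neg, Real.exp_log hR₁, Real.exp_log hρ0]
        rfl
      rw [h2, le_div_iff₀ hρ0] at h1
      have hv0 : 0 ≤ v := by
        have := Real.log_le_log hR₁ hx.1
        rw [hv]; linarith
      nlinarith [mul_le_mul_of_nonneg_right hx.2 hv0]
    have hgx : 1 - L * (R₂ * v) ≤ g (ρ x • (x : Ambient n)) := by
      have h1 := (abs_le.1 (hL x (ρ x) hx R₁ ⟨le_rfl, hR₁₂.le⟩)).1
      rw [abs_of_nonneg (sub_nonneg.2 hx.1)] at h1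
      have h2 := mul_le_mul_of_nonneg_left hρv hL0
      linarith [hg_inner x]
    have hv0 : 0 ≤ v := by nlinarith [hx.1]
    have h3 : n / 2 * (1 + (1 - L * (R₂ * v))) * (1 + p ^ 2) ≤
        n / 2 * (1 + g (ρ x • (x : Ambient n))) * (1 + p ^ 2) := by gcongr
    have h4 : n * L * R₂ * v * (1 + p ^ 2) ≤ n * L * R₂ * v * (1 + P ^ 2) := by gcongr
    have h5 : 0 ≤ n * L * R₂ * (1 + P ^ 2) * p := by positivity
    have h6 : 0 ≤ n * L * R₂ * v * (1 + p ^ 2) := by positivity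
    have h7 : 0 ≤ (n - 1) * p ^ 2 := mul_nonneg (by linarith) (sq_nonneg p)
    nlinarith

/-- The function `v = log (R₂ / ρ) ≥ 0` satisfies `Δ v ≤ C (v + |∇v|)`. Here the term
`(n - 1) |∇v|²` has the unfavourable sign, and is absorbed by the gradient term because `∇v` is
bounded. -/
theorem IsSolution.eq_outer_or_lt (hn : 1 ≤ n) (hα : 0 < α) (hR₁ : 0 < R₁)
    (hR₁₂ : R₁ < R₂) (hg : IsC1Holder α g (annulus n R₁ R₂))
    (hg_outer : ∀ x : Sph n, g (R₂ • (x : Ambient n)) ≤ 1) (hρ : IsSolution R₁ R₂ g ρ) :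
    (∀ x, ρ x = R₂) ∨ ∀ x, ρ x < R₂ := by
  have hJ := hρ.1.isSphericalJet
  obtain ⟨L, hL0, hL⟩ := hg.exists_lipschitz_radial hα hR₁
  obtain ⟨P, hP0, hP⟩ := hJ.exists_norm_le
  have hR₂ : 0 < R₂ := hR₁.trans hR₁₂
  have hn1 : (1 : ℝ) ≤ n := by exact_mod_cast hn
  have key := (hJ.neg.const_add (Real.log R₂)).eq_zero_or_pos hn
    (C := n * L * R₂ * (1 + P ^ 2) + n * P) (fun x => ?_) (by positivity) fun x => ?_
  · simp only [logExt_coe] at key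
    refine key.imp (fun h x => ?_) fun h x => ?_
    · exact Real.log_injOn_pos (hρ.1.2 x) hR₂ (by linarith [h x])
    · exact (Real.log_lt_log_iff (hρ.1.2 x) hR₂).1 (by linarith [h x])
  · rw [logExt_coe]
    have := Real.log_le_log (hρ.1.2 x) (hρ.2.1 x).2
    linarith
  · have hx := hρ.2.1 x
    rw [sphLaplacian_neg, hρ.sphLaplacian_eq, logExt_coe, norm_neg]
    set v := Real.log R₂ + -Real.log (ρ x) with hv
    set p := ‖gradient (logExt ρ) x‖ with hp
    have hp0 : 0 ≤ p := norm_nonneg _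
    have hpP : p ^ 2 ≤ P ^ 2 := pow_le_pow_left₀ hp0 (hP x) 2
    have hρ0 := hρ.1.2 x
    -- `1 - v ≤ exp (-v) = ρ / R₂`
    have hρv : R₂ - ρ x ≤ R₂ * v := by
      have h1 := Real.add_one_le_exp (-v)
      have h2 : Real.exp (-v) = ρ x / R₂ := by
        rw [hv, neg_add, neg_neg, add_comm, Real.exp_add, Real.exp_neg, Real.exp_log hR₂,
          Real.exp_log hρ0]
        rfl
      rw [h2, le_div_iff₀ hR₂] at h1
      linarith
    have hgx : g (ρ x • (x : Ambient n)) ≤ 1 + L * (R₂ * v) := by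
      have h1 := (abs_le.1 (hL x (ρ x) hx R₂ ⟨hR₁₂.le, le_rfl⟩)).2
      rw [abs_sub_comm, abs_of_nonneg (sub_nonneg.2 hx.2)] at h1
      have h2 := mul_le_mul_of_nonneg_left hρv hL0
      linarith [hg_outer x]
    have hv0 : 0 ≤ v := by nlinarith [hx.2]
    have h3 : n / 2 * (1 + g (ρ x • (x : Ambient n))) * (1 + p ^ 2) ≤
        n / 2 * (1 + (1 + L * (R₂ * v))) * (1 + p ^ 2) := by gcongr
    have h4 : n * L * R₂ * v * (1 + p ^ 2) ≤ n * L * R₂ * v * (1 + P ^ 2) := by gcongr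
    have h5 : 0 ≤ n * L * R₂ * (1 + P ^ 2) * p := by positivity
    have h6 : 0 ≤ n * L * R₂ * v * (1 + p ^ 2) := by positivity
    have h7 : (n : ℝ) * (p * p) ≤ n * (P * p) := by gcongr; exact hP x
    have h8 : 0 ≤ n * P * v := by positivity
    nlinarith

/-- With `M = max log (ρ₁ / ρ₂) > 0`, the function `v = M - log (ρ₁ / ρ₂) ≥ 0` satisfies
`Δ v ≤ C (v + |∇v|)`, and it has a zero. -/
theorem IsSolution.exists_eq_mul_of_lt (hn : 1 ≤ n) (hR₁ : 0 < R₁)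
    (hg_pos : ∀ y ∈ annulus n R₁ R₂, 0 < g y) (hg : IsC1Holder α g (annulus n R₁ R₂))
    (hmono : ∀ x : Sph n, ∀ t ∈ Icc R₁ R₂,
      derivWithin (fun s : ℝ => g (s • (x : Ambient n))) (Icc R₁ R₂) t ≤ 0)
    (h₁ : IsSolution R₁ R₂ g ρ₁) (h₂ : IsSolution R₁ R₂ g ρ₂) (hlt : ∃ x, ρ₂ x < ρ₁ x) :
    ∃ C : ℝ, 0 < C ∧ ∀ x, ρ₁ x = C * ρ₂ x := by
  have hJ₁ := h₁.1.isSphericalJet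
  have hJ₂ := h₂.1.isSphericalJet
  obtain ⟨B, hB⟩ := isCompact_annulus.exists_bound_of_continuousOn hg.1.continuousOn
  obtain ⟨P₁, hP₁0, hP₁⟩ := hJ₁.exists_norm_le
  obtain ⟨P₂, hP₂0, hP₂⟩ := hJ₂.exists_norm_le
  obtain ⟨x₀, hx₀⟩ := hlt
  -- `M` is the maximum of `log ρ₁ - log ρ₂`, attained at `y`
  obtain ⟨y, -, hy⟩ := isCompact_univ.exists_isMaxOn (s := (univ : Set (Sph n)))
    ⟨x₀, mem_univ x₀⟩ (hJ₁.sub hJ₂).continuous_sph.continuousOn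
  set M := logExt ρ₁ y - logExt ρ₂ y with hM
  have hle : ∀ x : Sph n, logExt ρ₁ x - logExt ρ₂ x ≤ M := fun x => hy (mem_univ x)
  have hM0 : 0 < M := by
    refine lt_of_lt_of_le ?_ (hle x₀)
    rw [logExt_coe, logExt_coe, sub_pos]
    exact Real.log_lt_log (h₂.1.2 x₀) hx₀
  have hB0 : 0 ≤ B := (norm_nonneg _).trans (hB _ (smul_mem_annulus hR₁ x₀ (h₁.2.1 x₀)))
  set K₁ := (P₁ + P₂) * (1 + n * (1 + B)) with hK₁
  set K₂ := P₂ ^ 2 + n * (1 + B) * (1 + P₁ ^ 2) with hK₂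
  have hK₁0 : 0 ≤ K₁ := by positivity
  have hK₂0 : 0 ≤ K₂ := by positivity
  have key := ((hJ₁.sub hJ₂).neg.const_add M).eq_zero_or_pos hn (C := K₁ + K₂ / M)
    (fun x => by linarith [hle x]) (by positivity) fun x => ?_
  · rcases key with key | key
    · refine ⟨Real.exp M, Real.exp_pos M, fun x => ?_⟩
      have := key x
      rw [logExt_coe, logExt_coe] at this
      rw [← Real.exp_log (h₁.1.2 x), ← Real.exp_log (h₂.1.2 x), ← Real.exp_add]
      congr 1
      linarith
    · have := key y
      rw [← hM] at this
      linarith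
  · rw [sphLaplacian_neg, sphLaplacian_sub, h₁.sphLaplacian_eq, h₂.sphLaplacian_eq, norm_neg]
    set d := ‖gradient (logExt ρ₁) x - gradient (logExt ρ₂) x‖ with hd
    have hd0 : 0 ≤ d := norm_nonneg _
    have hpd : |‖gradient (logExt ρ₁) x‖ - ‖gradient (logExt ρ₂) x‖| ≤ d :=
      abs_norm_sub_norm_le _ _
    have hp₁P := hP₁ x
    have hp₂P := hP₂ x
    set p₁ := ‖gradient (logExt ρ₁) x‖ with hp₁
    set p₂ := ‖gradient (logExt ρ₂) x‖ with hp₂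
    have hp₁0 : 0 ≤ p₁ := norm_nonneg _
    have hp₂0 : 0 ≤ p₂ := norm_nonneg _
    have hm₁ := smul_mem_annulus hR₁ x (h₁.2.1 x)
    have hm₂ := smul_mem_annulus hR₁ x (h₂.2.1 x)
    have hgB₁ : g (ρ₁ x • (x : Ambient n)) ≤ B := (le_abs_self _).trans (hB _ hm₁)
    have hgB₂ : g (ρ₂ x • (x : Ambient n)) ≤ B := (le_abs_self _).trans (hB _ hm₂)
    have hg₁0 := hg_pos _ hm₁
    have hg₂0 := hg_pos _ hm₂
    have hv0 : 0 ≤ M + -(logExt ρ₁ x - logExt ρ₂ x) := by linarith [hle x]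
    have hn0 : (0 : ℝ) ≤ n := n.cast_nonneg
    rcases lt_or_ge (ρ₂ x) (ρ₁ x) with hlt | hge
    -- where `ρ₂ < ρ₁`, monotonicity of `g` eliminates the zeroth-order difference
    · have hgg : g (ρ₁ x • (x : Ambient n)) ≤ g (ρ₂ x • (x : Ambient n)) :=
        hg.antitoneOn_radial hR₁ (hmono x) (h₂.2.1 x) (h₁.2.1 x) hlt.le
      set g₁ := g (ρ₁ x • (x : Ambient n))
      set g₂ := g (ρ₂ x • (x : Ambient n))
      set v := M + -(logExt ρ₁ x - logExt ρ₂ x)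
      have e1 : n / 2 * (1 + g₁) * (1 + p₁ ^ 2) ≤ n / 2 * (1 + g₂) * (1 + p₁ ^ 2) := by gcongr
      have e2 : |p₁ ^ 2 - p₂ ^ 2| ≤ (P₁ + P₂) * d := by
        rw [sq_sub_sq, abs_mul, abs_of_nonneg (by positivity)]
        gcongr
      have e3 : (p₁ ^ 2 - p₂ ^ 2) * (n / 2 * (1 + g₂) - 1) ≤
          (P₁ + P₂) * d * (1 + n * (1 + B)) := by
        refine (le_abs_self _).trans ?_
        rw [abs_mul]
        have : |n / 2 * (1 + g₂) - 1| ≤ 1 + n * (1 + B) := by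
          have f1 : n / 2 * (1 + g₂) ≤ n * (1 + B) := by gcongr; linarith
          have f2 : 0 ≤ n / 2 * (1 + g₂) := by positivity
          rw [abs_le]
          constructor <;> linarith
        gcongr
      have e4 : 0 ≤ K₂ / M * (v + d) := by positivity
      have e5 : 0 ≤ K₁ * v := by positivity
      have e6 : K₁ * d = (P₁ + P₂) * d * (1 + n * (1 + B)) := by rw [hK₁]; ring
      linarith
    -- where `ρ₁ ≤ ρ₂`, `v ≥ M` is bounded away from zero, and a bound of `Δ v` suffices
    · have hvM : M ≤ M + -(logExt ρ₁ x - logExt ρ₂ x) := by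
        rw [logExt_coe, logExt_coe]
        linarith [Real.log_le_log (h₁.1.2 x) hge]
      set g₁ := g (ρ₁ x • (x : Ambient n))
      set g₂ := g (ρ₂ x • (x : Ambient n))
      set v := M + -(logExt ρ₁ x - logExt ρ₂ x)
      have e1 : n / 2 * (1 + g₁) * (1 + p₁ ^ 2) ≤ n * (1 + B) * (1 + P₁ ^ 2) := by
        gcongr; linarith
      have e2 : 0 ≤ n / 2 * (1 + g₂) * (1 + p₂ ^ 2) := by positivity
      have e3 : p₂ ^ 2 ≤ P₂ ^ 2 := pow_le_pow_left₀ hp₂0 hp₂P 2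
      have e4 : K₂ ≤ K₂ / M * v := by
        calc K₂ = K₂ / M * M := by field_simp
          _ ≤ K₂ / M * v := by gcongr
      have e5 : 0 ≤ K₁ * (v + d) := by positivity
      have e6 : 0 ≤ K₂ / M * d := by positivity
      have e7 : 0 ≤ p₁ ^ 2 := sq_nonneg _
      linarith

end Solution

end Reflector

theorem mainTheorem3 (n : ℕ) (hn : 1 ≤ n) (α : ℝ≥0) (hα₀ : 0 < α) (hα₁ : α < 1)
    (R₁ R₂ : ℝ) (hR₁ : 0 < R₁) (hR₁₂ : R₁ < R₂)
    (g : Reflector.Ambient n → ℝ)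
    (hg_pos : ∀ y ∈ Reflector.annulus n R₁ R₂, 0 < g y)
    (hg_reg : Reflector.IsC1Holder α g (Reflector.annulus n R₁ R₂))
    (hg_inner : ∀ x : Reflector.Sph n, 1 ≤ g (R₁ • (x : Reflector.Ambient n)))
    (hg_outer : ∀ x : Reflector.Sph n, g (R₂ • (x : Reflector.Ambient n)) ≤ 1) :
    ((∀ x : Reflector.Sph n, ∀ t ∈ Set.Icc R₁ R₂,
        derivWithin (fun s : ℝ => g (s • (x : Reflector.Ambient n))) (Set.Icc R₁ R₂) t ≤ 0) →
      ∀ ρ₁ ρ₂ : Reflector.Sph n → ℝ,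
        Reflector.IsSolution R₁ R₂ g ρ₁ → Reflector.IsSolution R₁ R₂ g ρ₂ →
        ∃ C : ℝ, 0 < C ∧ ∀ x, ρ₁ x = C * ρ₂ x) ∧
    (∀ ρ : Reflector.Sph n → ℝ, Reflector.IsSolution R₁ R₂ g ρ →
      (∀ x, ρ x = R₁) ∨ (∀ x, ρ x = R₂) ∨ (∀ x, R₁ < ρ x ∧ ρ x < R₂)) := by
  refine ⟨fun hmono ρ₁ ρ₂ h₁ h₂ => ?_, fun ρ hρ => ?_⟩
  · by_cases h12 : ∃ x, ρ₂ x < ρ₁ x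
    · exact h₁.exists_eq_mul_of_lt hn hR₁ hg_pos hg_reg hmono h₂ h12
    by_cases h21 : ∃ x, ρ₁ x < ρ₂ x
    · obtain ⟨C, hC, h⟩ := h₂.exists_eq_mul_of_lt hn hR₁ hg_pos hg_reg hmono h₁ h21
      exact ⟨C⁻¹, inv_pos.2 hC, fun x => by rw [h x, inv_mul_cancel_left₀ hC.ne']⟩
    push Not at h12 h21
    exact ⟨1, one_pos, fun x => by rw [one_mul]; exact le_antisymm (h12 x) (h21 x)⟩
  · rcases hρ.eq_inner_or_lt hn hα₀ hR₁ hR₁₂ hg_reg hg_inner with h | h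
    · exact Or.inl h
    rcases hρ.eq_outer_or_lt hn hα₀ hR₁ hR₁₂ hg_reg hg_outer with h' | h'
    · exact Or.inr (Or.inl h')
    · exact Or.inr (Or.inr fun x => ⟨h x, h' x⟩)
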